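/- All tournaments are finite. For a tournament $H$, a real number $\epsilon>0$ is called an Erd\H{o}s--Hajnal (EH) coefficient of $H$ if, for every $n$, every $n$-vertex tournament that contains no copy of $H$ as an induced subtournament contains a transitive (that is, having no directed cycle) subtournament on at least $n^{\epsilon}$ vertices. A set $S\subseteq V(H)$ is homogeneous if for every $v\in V(H)\setminus S$ either $(w,v)\in E(H)$ for all $w\in S$, or $(v,w)\in E(H)$ for all $w\in S$; it is nontrivial if $|S|>1$ and $S\neq V(H)$. The partitioning number $p(H)$ of a tournament $H$ with at least two vertices is the smallest number of parts in a partition of $V(H)$ into nonempty homogeneous sets that is not the one-part partition $\{V(H)\}$. Theorem. For every $\eta>0$ there exists $C(\eta)>0$ such that every tournament $H$ with $|H|\geq 3$ vertices, all of whose nontrivial homogeneous sets have size at most $\frac{\sqrt{|H|}}{2}$, satisfies $$\epsilon(H)\leq C(\eta)\,\frac{\log p(H)}{p(H)^{\frac12-\eta}}$$ for every EH coefficient $\epsilon(H)$ of $H$, where $\log$ is the natural logarithm. -/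

import Mathlib

/-- A tournament on the vertex set `V`: a loopless directed graph in which, for every pair of
distinct vertices, exactly one of the two possible edges is present. `Adj v w` says that
`(v, w)` is an edge. -/
structure Tournament (V : Type*) extends Digraph V where
  /-- There are no loops. -/
  loopless : ∀ v, ¬ Adj v v
  /-- Exactly one of the edges `(v, w)` and `(w, v)` exists. -/
  exactly_one : ∀ v w, v ≠ w → Xor (Adj v w) (Adj w v)

namespace Tournament

/-- The subtournament induced by a set of vertices. -/
def induce {V : Type*} (T : Tournament V) (S : Set V) : Tournament S where
  Adj a b := T.Adj a b
  loopless a := T.loopless a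
  exactly_one a b hab := T.exactly_one a b fun h => hab (Subtype.ext h)

/-- A tournament is transitive if it contains no directed cycle, that is, no vertex can be
reached from itself along a directed walk with at least one edge. -/
def IsTransitive {V : Type*} (T : Tournament V) : Prop :=
  ∀ v, ¬ Relation.TransGen T.Adj v v

/-- `T` is `H`-free if it does not contain a copy of `H` as an induced subtournament. -/
def IsFree {W V : Type*} (T : Tournament W) (H : Tournament V) : Prop :=
  IsEmpty (H.Adj ↪r T.Adj)

/-- `ε > 0` is an Erdős–Hajnal coefficient of `H`: every `n`-vertex `H`-free tournament contains a
transitive subtournament of size at least `n ^ ε`. -/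
def IsEHCoefficient {V : Type*} (H : Tournament V) (ε : ℝ) : Prop :=
  0 < ε ∧ ∀ (n : ℕ) (T : Tournament (Fin n)), T.IsFree H →
    ∃ S : Set (Fin n), (T.induce S).IsTransitive ∧ (n : ℝ) ^ ε ≤ (S.ncard : ℝ)

/-- A set `S` of vertices is homogeneous if every vertex outside `S` is either adjacent from all of
`S` or adjacent to all of `S`. -/
def IsHomogeneous {V : Type*} (H : Tournament V) (S : Set V) : Prop :=
  ∀ v, v ∉ S → (∀ w ∈ S, H.Adj w v) ∨ (∀ w ∈ S, H.Adj v w)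

/-- A homogeneous set is nontrivial if it has more than one element and is not the whole vertex
set. -/
def IsNontrivialHomogeneous {V : Type*} (H : Tournament V) (S : Set V) : Prop :=
  H.IsHomogeneous S ∧ 1 < S.ncard ∧ S ≠ Set.univ

/-- `P` is a nontrivial homogeneous partitioning: a partition of the vertex set into (nonempty)
homogeneous sets which does not consist of the whole vertex set alone. -/
def IsNontrivialHomogeneousPartition {V : Type*} (H : Tournament V) (P : Set (Set V)) : Prop :=
  Setoid.IsPartition P ∧ (∀ S ∈ P, H.IsHomogeneous S) ∧ P ≠ {Set.univ}

/-- The partitioning number `p(H)`: the smallest number of parts of a nontrivial homogeneous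
partitioning. (For a finite tournament with at least two vertices such a partitioning exists, the
one into singletons.) -/
noncomputable def partitioningNumber {V : Type*} (H : Tournament V) : ℕ :=
  sInf {k : ℕ | ∃ P : Set (Set V), H.IsNontrivialHomogeneousPartition P ∧ P.ncard = k}

end Tournament

/-! The bound comes from random tournaments, as for Ramsey numbers. Let `h = |H|`. A fixed injection
of the `h` vertices into `n` vertices is a copy of `H` with probability `2 ^ (-h.choose 2)`, and
likewise for the transitive tournament on `h` vertices. If `2 * n ^ h < 2 ^ h.choose 2`, some
`n`-vertex tournament therefore avoids both (`exists_isFree_of_lt`). Taking `n = 2 ^ m` with `m`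
linear in `h` forces `2 ^ (m * ε) ≤ h`, so `ε = O(log h / h)` (`IsEHCoefficient.le`). Since `2 ≤
p(H) ≤ h` and `log x / x` is decreasing up to a constant factor, `ε = O(log p / p)`, which is
stronger than the claim because `p ^ (1/2 - η) ≤ p`. -/

namespace Tournament

open Finset

/-- The transitive tournament given by a linear order. -/
def ofLinearOrder (V : Type*) [LinearOrder V] : Tournament V where
  Adj a b := a < b
  loopless := lt_irrefl
  exactly_one a b hab := by
    rcases lt_or_gt_of_ne hab with h | h
    · exact Or.inl ⟨h, h.asymm⟩
    · exact Or.inr ⟨h, h.asymm⟩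

/-- The tournament on a linear order in which the pair `{i, j}` is directed upwards if and only if
`f {i, j}` is true. -/
def ofPairs {W : Type*} [LinearOrder W] (f : Finset W → Bool) : Tournament W where
  Adj i j := i ≠ j ∧ (i < j ↔ f {i, j} = true)
  loopless _ h := h.1 rfl
  exactly_one i j hij := by
    rw [Finset.pair_comm j i]
    rcases lt_or_gt_of_ne hij with h | h <;> cases f {i, j} <;>
      simp [Xor, h, h.asymm, hij, hij.symm]

lemma eq_of_ofPairs_adj_iff {W : Type*} [LinearOrder W] {f g : Finset W → Bool} {i j : W}
    (hij : i ≠ j) (h : (ofPairs f).Adj i j ↔ (ofPairs g).Adj i j) : f {i, j} = g {i, j} := by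
  have h' : (i < j ↔ f {i, j} = true) ↔ (i < j ↔ g {i, j} = true) := by
    simpa [ofPairs, hij] using h
  rw [Bool.eq_iff_iff]
  tauto

/-- A set of Boolean functions which all agree on `s` is small. -/
lemma card_mul_two_pow_le {ι : Type*} [Fintype ι] [DecidableEq ι] (A : Finset (ι → Bool))
    (s : Finset ι) (hA : ∀ f ∈ A, ∀ g ∈ A, ∀ i ∈ s, f i = g i) :
    #A * 2 ^ #s ≤ 2 ^ Fintype.card ι := by
  rcases A.eq_empty_or_nonempty with rfl | ⟨g, hg⟩
  · simp
  have hsub : A ⊆ Fintype.piFinset fun i => if i ∈ s then {g i} else Finset.univ := by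
    intro f hf
    rw [Fintype.mem_piFinset]
    intro i
    split_ifs with hi
    · simpa using hA f hf g hg i hi
    · simp
  have hcard := Finset.card_le_card hsub
  have h2 : ∀ i, #(if i ∈ s then {g i} else (Finset.univ : Finset Bool)) =
      if i ∈ s then 1 else 2 := by
    intro i; split_ifs <;> simp
  rw [Fintype.card_piFinset, Finset.prod_congr rfl fun i _ => h2 i, Finset.prod_ite] at hcard
  simp only [Finset.prod_const_one, one_mul, Finset.prod_const] at hcard
  have h3 : #(Finset.univ.filter fun i => i ∉ s) + #s = Fintype.card ι := by
    rw [← Finset.card_compl_add_card s]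
    congr 2
    ext; simp
  calc #A * 2 ^ #s ≤ 2 ^ #(Finset.univ.filter fun i => i ∉ s) * 2 ^ #s := by gcongr
    _ = _ := by rw [← pow_add, h3]

open Classical in
/-- The union bound for the number of tournaments containing a copy of `K`. -/
lemma card_not_isFree_le {V W : Type*} [Fintype V] [Fintype W] [LinearOrder W]
    (K : Tournament V) :
    #(Finset.univ.filter fun f : Finset W → Bool => ¬ (ofPairs f).IsFree K) *
        2 ^ (Fintype.card V).choose 2 ≤
      Fintype.card W ^ Fintype.card V * 2 ^ Fintype.card (Finset W) := by
  -- `A φ` is the event that `φ` is a copy of `K`. It fixes the bits on the pairs inside the image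
  -- of `φ`; all other bits, including the unused ones at sets that are not pairs, stay free.
  let A : (V → W) → Finset (Finset W → Bool) := fun φ => Finset.univ.filter fun f =>
    Function.Injective φ ∧ ∀ a b, (ofPairs f).Adj (φ a) (φ b) ↔ K.Adj a b
  have hA : ∀ φ, #(A φ) * 2 ^ (Fintype.card V).choose 2 ≤ 2 ^ Fintype.card (Finset W) := by
    intro φ
    by_cases hφ : Function.Injective φ
    · have hs : #(Finset.powersetCard 2 (Finset.univ.image φ)) = (Fintype.card V).choose 2 := by
        rw [Finset.card_powersetCard, Finset.card_image_of_injective _ hφ, Finset.card_univ]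
      rw [← hs]
      apply card_mul_two_pow_le
      intro f hf g hg e he
      simp only [A, Finset.mem_filter, Finset.mem_univ, true_and] at hf hg
      rw [Finset.mem_powersetCard, Finset.card_eq_two] at he
      obtain ⟨hsub, x, y, hxy, rfl⟩ := he
      obtain ⟨a, -, rfl⟩ := Finset.mem_image.1 (hsub (Finset.mem_insert_self x {y}))
      obtain ⟨b, -, rfl⟩ := Finset.mem_image.1
        (hsub (Finset.mem_insert_of_mem (Finset.mem_singleton_self y)))
      exact eq_of_ofPairs_adj_iff hxy ((hf.2 a b).trans (hg.2 a b).symm)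
    · simp [A, hφ]
  have hsub : (Finset.univ.filter fun f : Finset W → Bool => ¬ (ofPairs f).IsFree K) ⊆
      Finset.univ.biUnion A := by
    intro f hf
    simp only [Finset.mem_filter, Finset.mem_univ, true_and, IsFree, not_isEmpty_iff] at hf
    obtain ⟨φ⟩ := hf
    simp only [A, Finset.mem_biUnion, Finset.mem_filter, Finset.mem_univ, true_and]
    exact ⟨φ, φ.injective, fun a b => φ.map_rel_iff⟩
  calc _ ≤ (∑ φ, #(A φ)) * 2 ^ (Fintype.card V).choose 2 := by
        gcongr
        exact (Finset.card_le_card hsub).trans Finset.card_biUnion_le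
    _ = ∑ φ, #(A φ) * 2 ^ (Fintype.card V).choose 2 := Finset.sum_mul _ _ _
    _ ≤ ∑ _φ : V → W, 2 ^ Fintype.card (Finset W) := Finset.sum_le_sum fun φ _ => hA φ
    _ = _ := by simp

/-- A set inducing a transitive subtournament contains every transitive tournament of at most
its size. -/
lemma IsTransitive.not_isFree {V : Type*} [Finite V] {T : Tournament V} {S : Set V}
    (hS : (T.induce S).IsTransitive) {k : ℕ} (hk : k ≤ S.ncard) :
    ¬ T.IsFree (ofLinearOrder (Fin k)) := by
  classical
  have tri : ∀ a b : S, (T.induce S).Adj a b ∨ a = b ∨ (T.induce S).Adj b a := by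
    intro a b
    by_cases hab : a = b
    · exact Or.inr (Or.inl hab)
    · rcases (T.induce S).exactly_one a b hab with h | h
      · exact Or.inl h.1
      · exact Or.inr (Or.inr h.1)
  -- Without directed cycles, adjacency is a strict total order on `S`, so any shorter chain embeds
  -- in it.
  let r : S → S → Prop := (T.induce S).Adj
  have : IsStrictTotalOrder S r :=
    { irrefl := (T.induce S).loopless
      trans := by
        intro a b c hab hbc
        rcases tri a c with h | rfl | h
        · exact h
        · exact (hS a ((Relation.TransGen.single hab).tail hbc)).elim
        · exact (hS a (((Relation.TransGen.single hab).tail hbc).tail h)).elim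
      trichotomous := by
        intro a b hab hba
        rcases tri a b with h | h | h
        · exact (hab h).elim
        · exact h
        · exact (hba h).elim }
  let : LinearOrder S := linearOrderOfSTO r
  have : Fintype S := Fintype.ofFinite S
  have hcard : Fintype.card S = S.ncard := by
    rw [← Nat.card_eq_fintype_card]; rfl
  let e := (Fin.castLEOrderEmb hk).trans (Fintype.orderIsoFinOfCardEq S hcard).toOrderEmbedding
  have he : ∀ a b, T.Adj (e a : V) (e b : V) ↔ a < b := fun a b => OrderEmbedding.lt_iff_lt e
  exact fun hfree => hfree.false
    ⟨⟨fun a => (e a : V), fun a b h => e.injective (Subtype.ext h)⟩, fun {a b} => he a b⟩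

/-- If `n` is small, then some tournament on `n` vertices contains neither `H` nor a transitive
subtournament on `|H|` vertices. -/
lemma exists_isFree_of_lt {V : Type*} [Fintype V] (H : Tournament V) (n : ℕ)
    (hn : 2 * n ^ Fintype.card V < 2 ^ (Fintype.card V).choose 2) :
    ∃ T : Tournament (Fin n), T.IsFree H ∧
      ∀ S : Set (Fin n), (T.induce S).IsTransitive → S.ncard < Fintype.card V := by
  classical
  set h := Fintype.card V with hh
  have h1 := card_not_isFree_le (W := Fin n) H
  have h2 := card_not_isFree_le (W := Fin n) (ofLinearOrder (Fin h))
  rw [Fintype.card_fin] at h1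
  simp only [Fintype.card_fin] at h2
  by_contra! hcon
  have huniv : (Finset.univ : Finset (Finset (Fin n) → Bool)) ⊆
      (Finset.univ.filter fun f => ¬ (ofPairs f).IsFree H) ∪
        (Finset.univ.filter fun f => ¬ (ofPairs f).IsFree (ofLinearOrder (Fin h))) := by
    intro f _
    simp only [Finset.mem_union, Finset.mem_filter, Finset.mem_univ, true_and]
    by_cases hf : (ofPairs f).IsFree H
    · obtain ⟨S, hS, hle⟩ := hcon _ hf
      exact Or.inr (hS.not_isFree hle)
    · exact Or.inl hf
  have hcard := (Finset.card_le_card huniv).trans (Finset.card_union_le _ _)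
  rw [Finset.card_univ, Fintype.card_fun, Fintype.card_bool] at hcard
  -- If the two bad families covered everything, the union bounds would add up to `2 ^ h.choose 2 ≤
  -- 2 * n ^ h`.
  have h3 := Nat.mul_le_mul_right (2 ^ h.choose 2) hcard
  rw [add_mul] at h3
  have hpos : 0 < 2 ^ Fintype.card (Finset (Fin n)) := by positivity
  have h4 := Nat.mul_lt_mul_of_pos_right hn hpos
  rw [← hh] at h1
  linarith

lemma exists_isFree_two_pow {V : Type*} [Fintype V] (H : Tournament V)
    (hV : 3 ≤ Fintype.card V) :
    ∃ m : ℕ, Fintype.card V ≤ 5 * m ∧ ∃ T : Tournament (Fin (2 ^ m)), T.IsFree H ∧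
      ∀ S : Set (Fin (2 ^ m)), (T.induce S).IsTransitive → S.ncard < Fintype.card V := by
  rcases hV.eq_or_lt with hV | hV
  -- For `h = 3` the choice `m = (h - 2) / 2` below would be `0`; two vertices are too few for
  -- either structure.
  · refine ⟨1, by omega, ofLinearOrder _, ⟨fun φ => ?_⟩, fun S _ => ?_⟩
    · have := Fintype.card_le_of_injective φ φ.injective
      simp only [Fintype.card_fin] at this
      omega
    · have := Set.ncard_le_card S
      simp only [Nat.card_eq_fintype_card, Fintype.card_fin] at this
      omega
  -- The factor `5` is tight at `h = 5`, where `m = 1`.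
  · refine ⟨(Fintype.card V - 2) / 2, by omega, exists_isFree_of_lt H _ ?_⟩
    obtain ⟨k, hk⟩ := Nat.exists_eq_add_of_le (show 2 ≤ Fintype.card V by omega)
    rw [hk, ← pow_mul, ← pow_succ']
    apply Nat.pow_lt_pow_right (by norm_num)
    rw [Nat.choose_two_right,
      Nat.lt_div_iff_mul_lt' (Nat.even_mul_pred_self (2 + k)).two_dvd]
    have h1 : (2 + k - 2) / 2 * 2 ≤ k := by omega
    have h2 : 2 + k - 1 = k + 1 := by omega
    rw [h2]
    nlinarith [Nat.mul_le_mul_right (2 + k) h1]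

/-- Every Erdős–Hajnal coefficient of an `h`-vertex tournament is `O(log h / h)`. -/
lemma IsEHCoefficient.le {V : Type*} [Fintype V] {H : Tournament V} {ε : ℝ}
    (hε : H.IsEHCoefficient ε) (hV : 3 ≤ Fintype.card V) :
    ε ≤ 5 / Real.log 2 * (Real.log (Fintype.card V) / Fintype.card V) := by
  obtain ⟨m, hm, T, hT, hS⟩ := exists_isFree_two_pow H hV
  obtain ⟨S, hSt, hle⟩ := hε.2 _ T hT
  have hlt : (S.ncard : ℝ) ≤ Fintype.card V := by exact_mod_cast (hS S hSt).le
  have hlog := Real.log_le_log (by positivity) (hle.trans hlt)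
  rw [Real.log_rpow (by positivity), Nat.cast_pow, Real.log_pow, Nat.cast_ofNat] at hlog
  have h2 : 0 < Real.log 2 := Real.log_pos (by norm_num)
  have hh : (0 : ℝ) < Fintype.card V := by exact_mod_cast (by omega : 0 < Fintype.card V)
  have hm' : (Fintype.card V : ℝ) ≤ 5 * m := by exact_mod_cast hm
  rw [div_mul_div_comm, le_div_iff₀ (by positivity)]
  have := mul_le_mul_of_nonneg_left hm' (mul_pos hε.1 h2).le
  linarith

section PartitioningNumber

variable {V : Type*} [Nontrivial V] (H : Tournament V)

lemma isNontrivialHomogeneousPartition_singletons :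
    H.IsNontrivialHomogeneousPartition (Set.range fun v : V => ({v} : Set V)) := by
  refine ⟨⟨?_, fun v => ⟨{v}, ⟨⟨v, rfl⟩, rfl⟩, ?_⟩⟩, ?_, ?_⟩
  · rintro ⟨v, hv⟩
    exact Set.singleton_ne_empty v hv
  · rintro _ ⟨⟨w, rfl⟩, hw⟩
    rw [Set.mem_singleton_iff.1 hw]
  · rintro _ ⟨w, rfl⟩ v hv
    rcases H.exactly_one v w hv with h | h
    · right; rintro _ rfl; exact h.1
    · left; rintro _ rfl; exact h.1
  · intro h
    obtain ⟨a, b, hab⟩ := exists_pair_ne V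
    have ha : ({a} : Set V) = Set.univ := by
      rw [← Set.mem_singleton_iff, ← h]; exact ⟨a, rfl⟩
    exact hab (Set.mem_singleton_iff.1 (ha ▸ Set.mem_univ b : b ∈ ({a} : Set V))).symm

lemma partitioningNumber_le_card : H.partitioningNumber ≤ Nat.card V := by
  refine Nat.sInf_le ⟨_, H.isNontrivialHomogeneousPartition_singletons, ?_⟩
  rw [← Set.image_univ, Set.ncard_image_of_injective _ Set.singleton_injective, Set.ncard_univ]

/-- The singleton partition rules out the default value `sInf ∅ = 0`, so the infimum is attained. -/
lemma two_le_partitioningNumber [Finite V] : 2 ≤ H.partitioningNumber := by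
  obtain ⟨P, ⟨hP, -, hne⟩, hcard⟩ := Nat.sInf_mem
    (s := {k : ℕ | ∃ P : Set (Set V), H.IsNontrivialHomogeneousPartition P ∧ P.ncard = k})
    ⟨_, _, H.isNontrivialHomogeneousPartition_singletons, rfl⟩
  change P.ncard = H.partitioningNumber at hcard
  rw [← hcard]
  by_contra! hlt
  have hcover := hP.sUnion_eq_univ
  interval_cases hk : P.ncard
  · rw [Set.ncard_eq_zero] at hk
    rw [hk, Set.sUnion_empty] at hcover
    exact Set.empty_ne_univ hcover
  · obtain ⟨S, rfl⟩ := Set.ncard_eq_one.1 hk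
    rw [Set.sUnion_singleton] at hcover
    exact hne (by rw [hcover])

end PartitioningNumber

end Tournament

/-- `log x / x` decreases only from `e` on, hence the constant. Use `log (y / x) ≤ y / x`, then
absorb `1 / x` by `log 2 ≤ log x`. -/
lemma Real.log_div_self_le_of_le {x y : ℝ} (hx : 2 ≤ x) (hxy : x ≤ y) :
    Real.log y / y ≤ (1 + 1 / Real.log 2) * (Real.log x / x) := by
  have h2 : 0 < Real.log 2 := Real.log_pos (by norm_num)
  have hx0 : 0 < x := by linarith
  have hy0 : 0 < y := by linarith
  have hlx : Real.log 2 ≤ Real.log x := Real.log_le_log (by norm_num) hx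
  have h1 : Real.log y ≤ Real.log x + y / x := by
    have := Real.log_le_sub_one_of_pos (div_pos hy0 hx0)
    rw [Real.log_div hy0.ne' hx0.ne'] at this
    linarith
  have hone : 1 ≤ Real.log x / Real.log 2 := (one_le_div h2).2 hlx
  calc Real.log y / y ≤ (Real.log x + y / x) / y := by gcongr
    _ = Real.log x / y + 1 / x := by field_simp
    _ ≤ Real.log x / x + Real.log x / Real.log 2 / x := by
        have : 0 ≤ Real.log x := h2.le.trans hlx
        gcongr
    _ = _ := by ring

open Tournament in
theorem theorem7 (η : ℝ) (hη : 0 < η) :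
    ∃ C : ℝ, 0 < C ∧
      ∀ (V : Type*) [Fintype V] (H : Tournament V),
        3 ≤ Fintype.card V →
        (∀ S : Set V, H.IsNontrivialHomogeneous S →
          (S.ncard : ℝ) ≤ Real.sqrt (Fintype.card V) / 2) →
        ∀ ε : ℝ, H.IsEHCoefficient ε →
          ε ≤ C * (Real.log (H.partitioningNumber) /
            (H.partitioningNumber : ℝ) ^ (1 / 2 - η : ℝ)) := by
  have h2 : 0 < Real.log 2 := Real.log_pos (by norm_num)
  refine ⟨5 / Real.log 2 * (1 + 1 / Real.log 2), by positivity, ?_⟩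
  intro V _ H hV _ ε hε
  have : Nontrivial V := Fintype.one_lt_card_iff_nontrivial.1 (by omega)
  have hp2 : (2 : ℝ) ≤ H.partitioningNumber := by exact_mod_cast H.two_le_partitioningNumber
  have hpV : (H.partitioningNumber : ℝ) ≤ Fintype.card V := by
    exact_mod_cast Nat.card_eq_fintype_card (α := V) ▸ H.partitioningNumber_le_card
  -- The exponent is below `1` and the base at least `1`, so the constant need not depend on `η`.
  have hpow : (H.partitioningNumber : ℝ) ^ (1 / 2 - η : ℝ) ≤ H.partitioningNumber := by
    conv_rhs => rw [← Real.rpow_one (H.partitioningNumber : ℝ)]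
    exact Real.rpow_le_rpow_of_exponent_le (by linarith) (by linarith)
  have hlog : 0 ≤ Real.log H.partitioningNumber := Real.log_nonneg (by linarith)
  have hpow0 : 0 < (H.partitioningNumber : ℝ) ^ (1 / 2 - η : ℝ) :=
    Real.rpow_pos_of_pos (by linarith) _
  calc ε ≤ 5 / Real.log 2 * (Real.log (Fintype.card V) / Fintype.card V) := hε.le hV
    _ ≤ 5 / Real.log 2 * ((1 + 1 / Real.log 2) *
        (Real.log H.partitioningNumber / H.partitioningNumber)) := by
        gcongr
        exact Real.log_div_self_le_of_le hp2 hpV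
    _ ≤ 5 / Real.log 2 * ((1 + 1 / Real.log 2) *
        (Real.log H.partitioningNumber /
          (H.partitioningNumber : ℝ) ^ (1 / 2 - η : ℝ))) := by gcongr
    _ = _ := by ring
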